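/- A *ribbon graph* $G=(V,E)$ is a surface with boundary, represented as the union of two finite sets of discs, the vertices $V$ and the edges $E$, such that the vertices and edges intersect in disjoint line segments, each such segment lies on the boundary of precisely one vertex and precisely one edge, and every edge contains exactly two such segments. (Equivalently, $G$ is given by a signed rotation system.) Let $k(G)$ and $f(G)$ be the numbers of connected components and of boundary components of $G$; for $B\subseteq E$ let $G\setminus B$ be obtained from $G$ by deleting the edges in $B$, and for $C\subseteq E$ let $G^{\tau(C)}$ (the partial Petrial) be obtained from $G$ by adding a half-twist to each edge in $C$. The set system $D(G)=(E,\mathcal F)$ has as feasible sets the edge sets $A\subseteq E$ such that the restriction of the spanning ribbon subgraph $(V,A)$ to each connected component of $G$ has exactly one boundary component. Let $D=(E,\mathcal F)$ be a set system on a finite set $E$. It is a *delta-matroid* if $\mathcal F\neq\emptyset$ and for all $X,Y\in\mathcal F$ and $u\in X\bigtriangleup Y$ there is $v\in X\bigtriangleup Y$ (possibly $v=u$) with $X\bigtriangleup\{u,v\}\in\mathcal F$. For $A\subseteq E$ put $D*A=(E,\{A\bigtriangleup X: X\in\mathcal F\})$ (twist). For $e\in E$ put $D+e=(E,\mathcal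 F\bigtriangleup\{F\cup\{e\}:F\in\mathcal F,\ e\notin F\})$, and put $D+A=D+a_1+\cdots+a_n$ for $A=\{a_1,\dots,a_n\}$ (loop complementation), and $D\,\bar{*}\,A=((D*A)+A)*A$ (dual pivot). A delta-matroid is *vf-safe* if every sequence of twists and loop complementations, on subsets of $E$, turns it into a delta-matroid. Let $d_D=r(D_{\min})$ be the rank of the matroid whose bases are the feasible sets of $D$ of minimum cardinality. Let $\mathcal P_3(E)$ be the set of ordered partitions $(A,B,C)$ of $E$ into three possibly empty blocks. A weight system $(\boldsymbol\alpha,\boldsymbol\beta,\boldsymbol\gamma)$ consists of integers $\alpha_e,\beta_e,\gamma_e$ for each $e\in E$. Define, in $\mathbb Z[t]$, the topological transition polynomial of $G$ $$Q(G;(\boldsymbol\alpha,\boldsymbol\beta,\boldsymbol\gamma),t)=\sum_{(A,B,C)\in\mathcal P_3(E)}\Big(\prod_{e\in A}\alpha_e\Big)\Big(\prod_{e\in B}\beta_e\Big)\Big(\prod_{e\in C}\gamma_e\Big)\,t^{f(G^{\tau(C)}\setminus B)}$$ and the transition polynomial of a vf-safe delta-matroid $D$ on $E$ $$Q_{(\boldsymbol\alpha,\boldsymbol\beta,\boldsymbol\gamma)}(D;t)=\sum_{(A,B,C)\in\mathcal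 P_3(E)}\Big(\prod_{e\in A}\alpha_e\Big)\Big(\prod_{e\in B}\beta_e\Big)\Big(\prod_{e\in C}\gamma_e\Big)\,t^{d_{D*B\bar{*}C}}.$$ **Proposition.** Let $G=(V,E)$ be a ribbon graph. Then $D(G)$ is a vf-safe delta-matroid, and for every weight system $(\boldsymbol\alpha,\boldsymbol\beta,\boldsymbol\gamma)$ $$Q(G;(\boldsymbol\alpha,\boldsymbol\beta,\boldsymbol\gamma),t)=t^{k(G)}\,Q_{(\boldsymbol\beta,\boldsymbol\alpha,\boldsymbol\gamma)}(D(G);t).$$ -/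

import Mathlib

open Polynomial
open scoped symmDiff

/-! ### Set systems and delta-matroids -/

/-- A set system whose ground set is the finite type `E`. -/
@[ext]
structure SetSystem (E : Type*) where
  /-- The collection of feasible sets. -/
  feasible : Finset (Finset E)

namespace SetSystem

variable {E : Type*} [DecidableEq E]

/-- A delta-matroid: a proper set system with the symmetric exchange property
(the case `v = u` is allowed). -/
def IsDeltaMatroid (D : SetSystem E) : Prop :=
  D.feasible.Nonempty ∧
    ∀ X ∈ D.feasible, ∀ Y ∈ D.feasible, ∀ u ∈ X ∆ Y,
      ∃ v ∈ X ∆ Y, X ∆ {u, v} ∈ D.feasible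

/-- The twist `D * A`. -/
def twist (D : SetSystem E) (A : Finset E) : SetSystem E where
  feasible := D.feasible.image (fun X => A ∆ X)

/-- Loop complementation `D + e` on one element. -/
def loopComplElem (D : SetSystem E) (e : E) : SetSystem E where
  feasible := D.feasible ∆ ((D.feasible.filter (fun F => e ∉ F)).image (fun F => insert e F))

theorem mem_loopComplElem (D : SetSystem E) (e : E) (X : Finset E) :
    X ∈ (D.loopComplElem e).feasible ↔
      Xor (X ∈ D.feasible) (e ∈ X ∧ X.erase e ∈ D.feasible) := by
  have key : X ∈ (D.feasible.filter (fun F => e ∉ F)).image (fun F => insert e F) ↔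
      e ∈ X ∧ X.erase e ∈ D.feasible := by
    simp only [Finset.mem_image, Finset.mem_filter]
    constructor
    · rintro ⟨F, ⟨hF, he⟩, rfl⟩
      exact ⟨Finset.mem_insert_self e F, by rwa [Finset.erase_insert he]⟩
    · rintro ⟨he, hX⟩
      exact ⟨X.erase e, ⟨hX, Finset.notMem_erase e X⟩, Finset.insert_erase he⟩
  simp only [loopComplElem, Finset.mem_symmDiff, key, Xor]

/-- Loop complementations on single elements commute. -/
instance : RightCommutative (loopComplElem : SetSystem E → E → SetSystem E) where
  right_comm D a b := by
    ext X
    simp only [mem_loopComplElem, Finset.mem_erase]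
    by_cases hab : a = b
    · subst hab; rfl
    · rw [Finset.erase_right_comm]
      simp only [Xor]
      grind

/-- Loop complementation `D + A = D + a₁ + ⋯ + aₙ` for `A = {a₁, …, aₙ}`. -/
def loopCompl (D : SetSystem E) (A : Finset E) : SetSystem E :=
  A.val.foldl loopComplElem D

/-- The dual pivot `((D * A) + A) * A`. -/
def dualPivot (D : SetSystem E) (A : Finset E) : SetSystem E :=
  ((D.twist A).loopCompl A).twist A

/-- `D.Reaches D'` means that `D'` arises from `D` by a finite sequence of twists and loop
complementations. -/
inductive Reaches (D : SetSystem E) : SetSystem E → Prop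
  | refl : Reaches D D
  | twist {D' : SetSystem E} (A : Finset E) : Reaches D D' → Reaches D (D'.twist A)
  | loopCompl {D' : SetSystem E} (A : Finset E) : Reaches D D' → Reaches D (D'.loopCompl A)

/-- A delta-matroid is vf-safe if every sequence of twists and loop complementations turns it
into a delta-matroid. -/
def IsVfSafe (D : SetSystem E) : Prop :=
  ∀ D' : SetSystem E, D.Reaches D' → D'.IsDeltaMatroid

/-- The set system `D_min` of the feasible sets of minimum cardinality. -/
def lower (D : SetSystem E) : SetSystem E where
  feasible := D.feasible.filter (fun F => ∀ F' ∈ D.feasible, F.card ≤ F'.card)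

/-- The rank of `A`: the largest size of the intersection of `A` with a feasible set (a basis,
for a matroid). -/
def rank (D : SetSystem E) (A : Finset E) : ℕ :=
  D.feasible.sup (fun B => (A ∩ B).card)

/-- `d_D = r(D_min)`, the rank of the lower matroid. -/
def lowerRank [Fintype E] (D : SetSystem E) : ℕ :=
  D.lower.rank Finset.univ

end SetSystem

/-- The ordered partitions `(A, B, C)` of `E` into three possibly empty blocks. -/
def orderedPartitions3 (E : Type*) [Fintype E] [DecidableEq E] :
    Finset (Finset E × Finset E × Finset E) :=
  Finset.univ.filter (fun P =>
    P.1 ∪ P.2.1 ∪ P.2.2 = Finset.univ ∧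
      Disjoint P.1 P.2.1 ∧ Disjoint P.1 P.2.2 ∧ Disjoint P.2.1 P.2.2)

/-- The transition polynomial `Q_{(α, β, γ)}(D; t)` of a (vf-safe) delta-matroid; `t` is the
variable `X` of `ℤ[X]`. -/
noncomputable def SetSystem.transitionPoly {E : Type*} [Fintype E] [DecidableEq E]
    (D : SetSystem E) (α β γ : E → ℤ) : ℤ[X] :=
  ∑ P ∈ orderedPartitions3 E,
    C ((∏ e ∈ P.1, α e) * (∏ e ∈ P.2.1, β e) * (∏ e ∈ P.2.2, γ e)) *
      X ^ ((D.twist P.2.1).dualPivot P.2.2).lowerRank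

/-! ### Ribbon graphs -/

/-- A ribbon graph with set of vertex discs `V` and set of edge discs `E`, given by its gluing
data (a signed rotation system).

The edge disc `e` meets the vertex discs in exactly two segments, its ends `(e, false)` and
`(e, true)`. Choose an orientation of the boundary circle of every vertex disc. Then `vert h` is
the vertex disc on whose boundary the end `h` lies, and `rot h` is the end that follows `h` on
that circle; so the ends on one vertex disc form one cycle of `rot`. A vertex disc that carries
no end is an isolated vertex. The edge disc `e` is glued to its two ends either compatibly with
the chosen orientations, or with a half-twist; the latter holds for `e ∈ twisted`. -/
structure RibbonGraph (V E : Type*) where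
  /-- The vertex disc on which an edge end lies. -/
  vert : E × Bool → V
  /-- The next edge end on the boundary of the same vertex disc. -/
  rot : Equiv.Perm (E × Bool)
  /-- The ends on one vertex disc are cyclically ordered by `rot`. -/
  vert_eq_iff : ∀ h h' : E × Bool, vert h = vert h' ↔ rot.SameCycle h h'
  /-- The edges that are glued with a half-twist. -/
  twisted : Finset E

namespace RibbonGraph

variable {V E : Type*} [DecidableEq E]

/-- The underlying graph (without loops and multiplicities, which do not matter for
connectedness). -/
def graph (G : RibbonGraph V E) : SimpleGraph V :=
  SimpleGraph.fromRel (fun v w => ∃ e : E, G.vert (e, false) = v ∧ G.vert (e, true) = w)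

/-- The number `k(G)` of connected components. -/
noncomputable def numComponents (G : RibbonGraph V E) : ℕ :=
  Nat.card G.graph.ConnectedComponent

/-- The partial Petrial `G^{τ(A)}`: a half-twist is added to every edge in `A`. -/
def petrial (G : RibbonGraph V E) (A : Finset E) : RibbonGraph V E where
  vert := G.vert
  rot := G.rot
  vert_eq_iff := G.vert_eq_iff
  twisted := G.twisted ∆ A

/-- Marked points on the boundaries of the vertex discs: for each edge end `h` the first point
`(h, false)` and the last point `(h, true)` of the segment `h`, in the direction of the chosen
orientation of the vertex boundary, and one point on the boundary of each isolated vertex. -/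
abbrev MarkedPoint (G : RibbonGraph V E) : Type _ :=
  ((E × Bool) × Bool) ⊕ {v : V // ∀ h : E × Bool, G.vert h ≠ v}

/-- The vertex disc on whose boundary a marked point lies. -/
def MarkedPoint.vertex (G : RibbonGraph V E) : G.MarkedPoint → V
  | Sum.inl c => G.vert c.1
  | Sum.inr v => v.1

/-- The arcs between marked points of which the boundary of the spanning ribbon subgraph `(V, A)`
is made up, apart from the closed boundary curves of the isolated vertices of `G`. The surface
`(V, A)` is the union of all vertex discs and of the edge discs in `A`. Its boundary consists of
* the arcs of the vertex boundaries between consecutive edge ends of `G`,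
* the segments along which the edges not in `A` were attached,
* the two free sides of each edge in `A`, each running from one end to the other end; for an edge
  without half-twist a side joins a first point to a last point, for an edge with a half-twist it
  joins two first points or two last points. -/
inductive BoundaryArc (G : RibbonGraph V E) (A : Finset E) : G.MarkedPoint → G.MarkedPoint → Prop
  | vertexArc (h : E × Bool) :
      BoundaryArc G A (Sum.inl (h, true)) (Sum.inl (G.rot h, false))
  | segment (h : E × Bool) (hh : h.1 ∉ A) :
      BoundaryArc G A (Sum.inl (h, false)) (Sum.inl (h, true))
  | side (e : E) (he : e ∈ A) (s : Bool) :
      BoundaryArc G A (Sum.inl ((e, false), s))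
        (Sum.inl ((e, true), if e ∈ G.twisted then s else !s))

/-- The boundary of the spanning ribbon subgraph `(V, A)`, as a graph on the marked points: its
connected components are the boundary components of `(V, A)`. -/
def boundary (G : RibbonGraph V E) (A : Finset E) : SimpleGraph G.MarkedPoint :=
  SimpleGraph.fromRel (G.BoundaryArc A)

/-- The number `f(V, A)` of boundary components of the spanning ribbon subgraph `(V, A)`. -/
noncomputable def numBoundary (G : RibbonGraph V E) (A : Finset E) : ℕ :=
  Nat.card (G.boundary A).ConnectedComponent

/-- The spanning ribbon subgraph `(V, A)` is a spanning quasi-tree of `G`: its restriction to each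
connected component `K` of `G` has exactly one boundary component. -/
def IsSpanningQuasiTree (G : RibbonGraph V E) (A : Finset E) : Prop :=
  ∀ K : G.graph.ConnectedComponent,
    ∃! b : (G.boundary A).ConnectedComponent,
      ∃ p : G.MarkedPoint, (G.boundary A).connectedComponentMk p = b ∧
        G.graph.connectedComponentMk (MarkedPoint.vertex G p) = K

open Classical in
/-- The delta-matroid `D(G)`: the feasible sets are the edge sets of the spanning quasi-trees. -/
noncomputable def deltaMatroid [Fintype E] (G : RibbonGraph V E) : SetSystem E where
  feasible := Finset.univ.filter (fun A => G.IsSpanningQuasiTree A)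

/-- The topological transition polynomial `Q(G; (α, β, γ), t)`, the sum over all
`(A, B, C) ∈ P₃(E)` of the products of weights times `t ^ f(G^{τ(C)} ∖ B)`; `t` is the variable
`X` of `ℤ[X]`, and deleting `B` leaves the spanning ribbon subgraph on the complement of `B`. -/
noncomputable def transitionPoly [Fintype E] (G : RibbonGraph V E) (α β γ : E → ℤ) : ℤ[X] :=
  ∑ P ∈ orderedPartitions3 E,
    C ((∏ e ∈ P.1, α e) * (∏ e ∈ P.2.1, β e) * (∏ e ∈ P.2.2, γ e)) *
      X ^ (G.petrial P.2.2).numBoundary P.2.1ᶜ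

end RibbonGraph

/-! Each edge has four marked points, on which the Klein four-group acts; its three nonzero elements
are the three ways to pair them: along the segments, along the free sides, and along the free sides
after a half-twist. A state chooses a pairing at every edge, and together with the vertex arcs it
forms closed circuits. All boundary components in question are circuits of states, and a spanning
quasi-tree is a state with the fewest possible circuits, one per connected component
(`IsBasisState`).

The key is local. Leave the four points of one edge unpaired: the rest of the state then joins them
in pairs by paths (`exists_pairing`), that is, by one pairing `k`. Choosing `k` closes the two paths
into separate circuits, while each of the other two choices merges them into one
(`exists_circuits_update`). So exactly one of the three choices has one circuit too many, and among
the three choices none or exactly two give a basis.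

For two states `a`, `b` that differ and are nonzero at every edge, `stateSystem` collects the sets
on which `a` must be replaced by `b` to give a basis. A twist exchanges `a` and `b`, and by "none or
two" loop complementation replaces `b` by `a + b`; so the class is closed under both. Each member is
a delta-matroid (`isDeltaMatroid_stateSystem`), hence vf-safe, and its lower rank is the number of
surplus circuits of `a` (`lowerRank_stateSystem`). As `D(G)` is such a system, the two polynomials
agree term by term. -/

/-! ### Two involutions -/

/-- Two involutions `N`, `M` of a finite type, where every fixed point of `N` is fixed by `M`:
an orbit of the group they generate that contains a point `a` fixed by `M` and not by `N`
contains exactly one further such point. -/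
theorem exists_second_fixedPoint {X : Type*} [Finite X] (N M : Equiv.Perm X)
    (hN : N * N = 1) (hM : M * M = 1) (hNM : ∀ x, N x = x → M x = x) (a : X)
    (hMa : M a = a) (hNa : N a ≠ a) :
    ∃ b : X, b ≠ a ∧ M b = b ∧ N b ≠ b ∧ (∃ i : ℤ, b = ((N * M) ^ i) a) ∧
      ∀ i : ℤ, M (((N * M) ^ i) a) = ((N * M) ^ i) a →
        ((N * M) ^ i) a = a ∨ ((N * M) ^ i) a = b := by
  obtain ⟨p, hp⟩ : ∃ p, p = N * M := ⟨_, rfl⟩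
  rw [← hp]
  have hMi : M⁻¹ = M := inv_eq_of_mul_eq_one_left hM
  have hNi : N⁻¹ = N := inv_eq_of_mul_eq_one_left hN
  -- The two involutions generate a dihedral group. On the points `(p ^ i) a`, with `i` taken modulo
  -- the period `n`, `M` acts as `i ↦ -i` and `N` as `i ↦ 1 - i`.
  have hconj : M * p * M⁻¹ = p⁻¹ := by
    rw [hp, mul_inv_rev, hMi, hNi, mul_assoc, mul_assoc, hM, mul_one]
  have hMp : ∀ i : ℤ, M ((p ^ i) a) = (p ^ (-i)) a := by
    intro i
    have h : M * p ^ i * M⁻¹ = p ^ (-i) := by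
      rw [← conj_zpow, hconj, inv_zpow, zpow_neg]
    rw [← h, Equiv.Perm.mul_apply, Equiv.Perm.mul_apply, hMi, hMa]
  have hNp : ∀ i : ℤ, N ((p ^ i) a) = (p ^ (1 - i)) a := by
    intro i
    have h : p * M = N := by rw [hp, mul_assoc, hM, mul_one]
    rw [show N ((p ^ i) a) = (p * M) ((p ^ i) a) by rw [h], Equiv.Perm.mul_apply, hMp,
      sub_eq_add_neg, zpow_add, zpow_one, Equiv.Perm.mul_apply]
  have hper : ∀ i : ℤ, (p ^ i) a = a ↔ (Function.minimalPeriod p a : ℤ) ∣ i := by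
    intro i
    exact MulAction.zpow_smul_eq_iff_minimalPeriod_dvd (a := p) (b := a)
  have heq : ∀ i j : ℤ, (p ^ i) a = (p ^ j) a ↔ (Function.minimalPeriod p a : ℤ) ∣ i - j := by
    intro i j
    rw [← hper, sub_eq_neg_add, zpow_add, Equiv.Perm.mul_apply, zpow_neg, Equiv.Perm.inv_eq_iff_eq]
  -- A point fixed by `N` is fixed by `M`, hence by `p`; then `p` fixes `a` too, and so does `N`.
  have hfix : ∀ i : ℤ, N ((p ^ i) a) ≠ (p ^ i) a := by
    intro i h
    have h2 : M ((p ^ i) a) = (p ^ i) a := hNM _ h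
    have h3 : p ((p ^ i) a) = (p ^ i) a := by rw [hp, Equiv.Perm.mul_apply, ← hp, h2, h]
    have h4 : (p ^ (1 + i)) a = (p ^ i) a := by
      rw [zpow_add, zpow_one, Equiv.Perm.mul_apply, h3]
    rw [heq] at h4
    have h5 : (p ^ (1 : ℤ)) a = a := by rw [hper]; simpa using h4
    rw [zpow_one, hp, Equiv.Perm.mul_apply, hMa] at h5
    exact hNa h5
  have hpos : 0 < Function.minimalPeriod p a := by
    apply Function.minimalPeriod_pos_of_mem_periodicPts
    exact Function.Injective.mem_periodicPts p.injective a
  set n := Function.minimalPeriod p a with hn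
  -- For `n = 2m + 1` the reflection `i ↦ 1 - i` would fix `i = m + 1`, contrary to `hfix`.
  have heven : Even n := by
    by_contra hodd
    rw [Nat.not_even_iff_odd] at hodd
    obtain ⟨m, hm⟩ := hodd
    apply hfix (m + 1)
    rw [hNp, heq]
    refine ⟨-1, ?_⟩
    rw [hm]; push_cast; ring
  obtain ⟨m, hm⟩ := heven
  -- With `n = 2m`, the reflection `i ↦ -i` fixes exactly `i = 0` and `i = m`.
  refine ⟨(p ^ (m : ℤ)) a, ?_, ?_, hfix _, ⟨m, rfl⟩, ?_⟩
  · rw [Ne, hper]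
    intro h
    have := Int.le_of_dvd (by omega) h
    omega
  · rw [hMp, heq]
    exact ⟨-1, by rw [hm]; push_cast; ring⟩
  · intro i hi
    rw [hMp, heq] at hi
    obtain ⟨c, hc⟩ := hi
    rw [hper, heq]
    rcases Int.even_or_odd c with ⟨d, hd⟩ | ⟨d, hd⟩
    · left
      refine ⟨-d, ?_⟩
      rw [hm] at hc ⊢; push_cast at hc ⊢; subst hd
      linarith
    · right
      refine ⟨-d - 1, ?_⟩
      rw [hm] at hc ⊢; push_cast at hc ⊢; subst hd
      linarith

/-! ### Gluing two points in a quotient -/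

-- The map `g` redirects the class of `y` to that of `x`: its kernel is `r'`, and its range misses
-- exactly the class of `y`.
open Classical in
theorem Setoid.card_quotient_glue {X : Type*} [Finite X] (r r' : Setoid X) (x y : X)
    (hxy : ¬ r x y) (hle : r ≤ r') (h' : r' x y)
    (hmin : ∀ t : Setoid X, r ≤ t → t x y → r' ≤ t) :
    Nat.card (Quotient r') + 1 = Nat.card (Quotient r) := by
  let g : X → Quotient r := fun z => if r z y then ⟦x⟧ else ⟦z⟧
  have hg : ∀ u v, r u v → g u = g v := by
    intro u v h
    have : r u y ↔ r v y := ⟨fun k => r.trans (r.symm h) k, fun k => r.trans h k⟩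
    simp only [g, this]
    split_ifs
    · rfl
    · exact Quotient.sound h
  have hr' : r' = Setoid.ker g := by
    apply le_antisymm
    · apply hmin
      · intro u v h; exact hg u v h
      · change g x = g y
        simp only [g, hxy, if_false]
        rw [if_pos (r.refl y)]
    · intro u v h
      have key : ∀ z, ∃ w, g z = ⟦w⟧ ∧ r' z w := by
        intro z
        by_cases hz : r z y
        · exact ⟨x, if_pos hz, r'.trans (hle hz) (r'.symm h')⟩
        · exact ⟨z, if_neg hz, r'.refl z⟩
      obtain ⟨w₁, h₁, k₁⟩ := key u
      obtain ⟨w₂, h₂, k₂⟩ := key v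
      have h3 : (⟦w₁⟧ : Quotient r) = ⟦w₂⟧ := by rw [← h₁, ← h₂]; exact h
      exact r'.trans k₁ (r'.trans (hle (Quotient.exact h3)) (r'.symm k₂))
  have hrange : Set.range g = {(⟦y⟧ : Quotient r)}ᶜ := by
    ext q
    simp only [Set.mem_range, Set.mem_compl_iff, Set.mem_singleton_iff]
    constructor
    · rintro ⟨z, rfl⟩ h
      by_cases hz : r z y
      · simp only [g, hz, if_true] at h
        exact hxy (Quotient.exact h)
      · simp only [g, hz, if_false] at h
        exact hz (Quotient.exact h)
    · intro h
      obtain ⟨z, rfl⟩ := Quotient.exists_rep q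
      refine ⟨z, if_neg fun hz => h (Quotient.sound hz)⟩
  rw [hr', Nat.card_congr (Setoid.quotientKerEquivRange g), hrange, Nat.card_coe_set_eq]
  have := Set.ncard_add_ncard_compl {(⟦y⟧ : Quotient r)}
  rw [Set.ncard_singleton] at this
  omega

theorem Setoid.eq_of_le_of_card_le {X : Type*} [Finite X] {r r' : Setoid X} (hle : r ≤ r')
    (hcard : Nat.card (Quotient r) ≤ Nat.card (Quotient r')) : r = r' := by
  let f : Quotient r → Quotient r' := Quotient.map id fun _ _ h => hle h
  have hf : Function.Surjective f := by
    intro q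
    obtain ⟨z, rfl⟩ := Quotient.exists_rep q
    exact ⟨⟦z⟧, rfl⟩
  have hb : Function.Bijective f := by
    have hc : Nat.card (Quotient r) = Nat.card (Quotient r') :=
      le_antisymm hcard (Nat.card_le_card_of_surjective f hf)
    exact (Nat.bijective_iff_surjective_and_card f).2 ⟨hf, hc⟩
  refine le_antisymm hle fun u v h => ?_
  have : f ⟦u⟧ = f ⟦v⟧ := Quotient.sound h
  exact Quotient.exact (hb.1 this)

theorem Setoid.card_le_card_of_le {X : Type*} [Finite X] {r r' : Setoid X} (hle : r ≤ r') :
    Nat.card (Quotient r') ≤ Nat.card (Quotient r) := by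
  apply Nat.card_le_card_of_surjective (Quotient.map id fun _ _ h => hle h)
  intro q
  obtain ⟨z, rfl⟩ := Quotient.exists_rep q
  exact ⟨⟦z⟧, rfl⟩

/-! ### The Klein four-group acting on the four marked points of an edge -/

/-- The componentwise exclusive or. -/
def kleinAdd (p q : Bool × Bool) : Bool × Bool := (xor p.1 q.1, xor p.2 q.2)

/-- The neutral element of `kleinAdd`. -/
abbrev kleinZero : Bool × Bool := (false, false)

theorem kleinAdd_kleinAdd_self : ∀ p q : Bool × Bool, kleinAdd (kleinAdd p q) q = p := by
  decide

theorem kleinAdd_zero : ∀ p : Bool × Bool, kleinAdd p kleinZero = p := by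
  decide

/-- If `g` exchanges zero and `k`, it must exchange the two remaining elements, which also differ by
`k`. -/
theorem eq_kleinAdd_of_involutive (g : Bool × Bool → Bool × Bool) (h₁ : ∀ p, g p ≠ p)
    (h₂ : ∀ p, g (g p) = p) (p : Bool × Bool) : g p = kleinAdd p (g kleinZero) := by
  have key : ∀ p k q : Bool × Bool, k ≠ kleinZero → p ≠ kleinZero → p ≠ k → q ≠ p →
      q ≠ kleinZero → q ≠ k → q = kleinAdd p k := by decide
  have zero_add : ∀ k, k = kleinAdd kleinZero k := by decide
  have add_self : ∀ k, kleinZero = kleinAdd k k := by decide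
  by_cases hp : p = kleinZero
  · subst hp; exact zero_add _
  by_cases hk : p = g kleinZero
  · rw [hk, h₂]; exact add_self _
  · refine key p _ _ (h₁ _) hp hk (h₁ p) (fun h => hk ?_) fun h => hp ?_
    · rw [← h, h₂]
    · rw [← h₂ p, h, h₂]

/-! ### Circuits of a state

A state assigns to each edge an element of the Klein four-group, which acts on the four marked
points of the edge. The nonzero elements are the three ways to pair up the four points. -/

section Circuits

variable {E I : Type*}

/-- The marked point of the edge `e` with coordinates `p`. -/
def markedPt (I : Type*) (e : E) (p : Bool × Bool) : ((E × Bool) × Bool) ⊕ I :=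
  Sum.inl ((e, p.1), p.2)

theorem markedPt_injective (e : E) : Function.Injective (markedPt I e) := by
  rintro ⟨a, b⟩ ⟨c, d⟩ h
  simpa [markedPt] using h

/-- The other end of the vertex arc at a marked point. -/
def vertexTurn (ρ : Equiv.Perm (E × Bool)) :
    ((E × Bool) × Bool) ⊕ I → ((E × Bool) × Bool) ⊕ I
  | Sum.inl (h, true) => Sum.inl (ρ h, false)
  | Sum.inl (h, false) => Sum.inl (ρ⁻¹ h, true)
  | Sum.inr i => Sum.inr i

/-- The other end of the arc at a marked point that is prescribed by the state `s`. -/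
def edgeTurn (s : E → Bool × Bool) : ((E × Bool) × Bool) ⊕ I → ((E × Bool) × Bool) ⊕ I
  | Sum.inl c => markedPt I c.1.1 (kleinAdd (c.1.2, c.2) (s c.1.1))
  | Sum.inr i => Sum.inr i

theorem edgeTurn_markedPt (s : E → Bool × Bool) (e : E) (p : Bool × Bool) :
    edgeTurn s (markedPt I e p) = markedPt I e (kleinAdd p (s e)) := rfl

theorem vertexTurn_involutive (ρ : Equiv.Perm (E × Bool)) :
    Function.Involutive (vertexTurn (I := I) ρ) := by
  rintro (⟨h, _ | _⟩ | i) <;> simp [vertexTurn]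

theorem edgeTurn_involutive (s : E → Bool × Bool) :
    Function.Involutive (edgeTurn (I := I) s) := by
  rintro (⟨⟨e, i⟩, j⟩ | i)
  · change edgeTurn s (edgeTurn s (markedPt I e (i, j))) = markedPt I e (i, j)
    rw [edgeTurn_markedPt, edgeTurn_markedPt, kleinAdd_kleinAdd_self]
  · rfl

theorem vertexTurn_markedPt_ne (ρ : Equiv.Perm (E × Bool)) (e : E) (p : Bool × Bool) :
    vertexTurn ρ (markedPt I e p) ≠ markedPt I e p := by
  obtain ⟨i, _ | _⟩ := p <;> simp [vertexTurn, markedPt]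

/-- The circuits of a state `s`: the classes of marked points that are joined by vertex arcs and
by the arcs prescribed by `s`. -/
def circuits (I : Type*) (ρ : Equiv.Perm (E × Bool)) (s : E → Bool × Bool) :
    Setoid (((E × Bool) × Bool) ⊕ I) :=
  Relation.EqvGen.setoid fun x y => y = vertexTurn ρ x ∨ y = edgeTurn s x

theorem circuits_vertexTurn (ρ : Equiv.Perm (E × Bool)) (s : E → Bool × Bool)
    (x : ((E × Bool) × Bool) ⊕ I) : circuits I ρ s x (vertexTurn ρ x) :=
  Relation.EqvGen.rel _ _ (Or.inl rfl)

theorem circuits_edgeTurn (ρ : Equiv.Perm (E × Bool)) (s : E → Bool × Bool)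
    (x : ((E × Bool) × Bool) ⊕ I) : circuits I ρ s x (edgeTurn s x) :=
  Relation.EqvGen.rel _ _ (Or.inr rfl)

theorem circuits_markedPt (ρ : Equiv.Perm (E × Bool)) (s : E → Bool × Bool) (e : E)
    (p : Bool × Bool) : circuits I ρ s (markedPt I e p) (markedPt I e (kleinAdd p (s e))) :=
  circuits_edgeTurn ρ s _

theorem circuits_le {ρ : Equiv.Perm (E × Bool)} {s : E → Bool × Bool}
    {r : Setoid (((E × Bool) × Bool) ⊕ I)} (h₁ : ∀ x, r x (vertexTurn ρ x))
    (h₂ : ∀ e p, r (markedPt I e p) (markedPt I e (kleinAdd p (s e)))) :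
    circuits I ρ s ≤ r := by
  apply Setoid.eqvGen_le
  rintro x y (rfl | rfl)
  · exact h₁ x
  · rcases x with ⟨⟨e, i⟩, j⟩ | i
    · exact h₂ e (i, j)
    · exact r.refl _

/-- If the state leaves exactly the four points of `e` unpaired, then the paths that the state
forms join these four points in pairs. -/
theorem exists_pairing [Finite E] [Finite I] (ρ : Equiv.Perm (E × Bool)) (s : E → Bool × Bool)
    (e : E) (he : s e = kleinZero) (hs : ∀ e', e' ≠ e → s e' ≠ kleinZero) :
    ∃ k : Bool × Bool, k ≠ kleinZero ∧ ∀ p q : Bool × Bool,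
      circuits I ρ s (markedPt I e p) (markedPt I e q) ↔ q = p ∨ q = kleinAdd p k := by
  let N : Equiv.Perm (((E × Bool) × Bool) ⊕ I) := (vertexTurn_involutive ρ).toPerm
  let M : Equiv.Perm (((E × Bool) × Bool) ⊕ I) := (edgeTurn_involutive s).toPerm
  have hN : N * N = 1 := Equiv.ext fun x => vertexTurn_involutive ρ x
  have hM : M * M = 1 := Equiv.ext fun x => edgeTurn_involutive s x
  have hNM : ∀ x, N x = x → M x = x := by
    rintro (⟨⟨e', i⟩, j⟩ | i) h
    · exact absurd h (vertexTurn_markedPt_ne ρ e' (i, j))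
    · rfl
  have hMpt : ∀ p, M (markedPt I e p) = markedPt I e p := by
    intro p
    change edgeTurn s (markedPt I e p) = _
    rw [edgeTurn_markedPt, he, kleinAdd_zero]
  have hrefl : ∀ x, circuits I ρ s x ((N * M) x) := fun x =>
    (circuits I ρ s).trans (circuits_edgeTurn ρ s x) (circuits_vertexTurn ρ s _)
  have horb : ∀ (i : ℤ) x, circuits I ρ s x (((N * M) ^ i) x) := by
    intro i x
    induction i with
    | zero => exact (circuits I ρ s).refl _
    | succ n ih =>
      rw [add_comm, zpow_add, zpow_one, Equiv.Perm.mul_apply]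
      exact (circuits I ρ s).trans ih (hrefl _)
    | pred n ih =>
      rw [sub_eq_add_neg, add_comm, zpow_add, zpow_neg_one, Equiv.Perm.mul_apply]
      refine (circuits I ρ s).trans ih ((circuits I ρ s).symm ?_)
      have := hrefl ((N * M)⁻¹ (((N * M) ^ (-(n : ℤ))) x))
      rwa [show ∀ y, (N * M) ((N * M)⁻¹ y) = y from (N * M).apply_symm_apply] at this
  have key : ∀ p, ∃ q, q ≠ p ∧ ∀ q', circuits I ρ s (markedPt I e p) (markedPt I e q') ↔
      q' = p ∨ q' = q := by
    intro p
    obtain ⟨b, hb, hMb, hNb, ⟨i, hi⟩, huniq⟩ := exists_second_fixedPoint N M hN hM hNM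
      (markedPt I e p) (hMpt p) (vertexTurn_markedPt_ne ρ e p)
    -- `M` moves the points of every other edge, where the state is nonzero, and `N` fixes the
    -- points of `I`; only the points of `e` remain.
    obtain ⟨q, rfl⟩ : ∃ q, b = markedPt I e q := by
      rcases b with ⟨⟨e', i⟩, j⟩ | i
      · by_cases h : e' = e
        · subst h; exact ⟨(i, j), rfl⟩
        · have h1 : markedPt I e' (kleinAdd (i, j) (s e')) = markedPt I e' (i, j) := hMb
          have h2 := markedPt_injective e' h1
          have h3 : ∀ p k : Bool × Bool, kleinAdd p k = p → k = kleinZero := by decide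
          exact absurd (h3 _ _ h2) (hs e' h)
      · exact absurd rfl hNb
    refine ⟨q, fun h => hb (by rw [h]), fun q' => ⟨fun h => ?_, ?_⟩⟩
    · have hle : circuits I ρ s ≤
          Setoid.ker fun x => ∃ i : ℤ, x = ((N * M) ^ i) (markedPt I e p) := by
        have hM' : ∀ x, (∃ i : ℤ, x = ((N * M) ^ i) (markedPt I e p)) →
            ∃ i : ℤ, M x = ((N * M) ^ i) (markedPt I e p) := by
          rintro x ⟨i, rfl⟩
          refine ⟨-i, ?_⟩
          have hMi : M⁻¹ = M := inv_eq_of_mul_eq_one_left hM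
          have hNi : N⁻¹ = N := inv_eq_of_mul_eq_one_left hN
          have hconj : M * (N * M) * M⁻¹ = (N * M)⁻¹ := by
            rw [mul_inv_rev, hMi, hNi, mul_assoc, mul_assoc, hM, mul_one]
          have h : M * (N * M) ^ i * M⁻¹ = (N * M) ^ (-i) := by
            rw [← conj_zpow, hconj, inv_zpow, zpow_neg]
          rw [← h, Equiv.Perm.mul_apply, Equiv.Perm.mul_apply, hMi, hMpt]
        have hN' : ∀ x, (∃ i : ℤ, x = ((N * M) ^ i) (markedPt I e p)) →
            ∃ i : ℤ, N x = ((N * M) ^ i) (markedPt I e p) := by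
          intro x hx
          obtain ⟨i, hi⟩ := hM' x hx
          refine ⟨1 + i, ?_⟩
          rw [zpow_add, zpow_one, Equiv.Perm.mul_apply, ← hi, Equiv.Perm.mul_apply]
          congr 1
          exact (edgeTurn_involutive s x).symm
        apply Setoid.eqvGen_le
        rintro x y (rfl | rfl)
        · refine propext ⟨hN' x, fun h => ?_⟩
          have := hN' _ h
          rwa [show N (vertexTurn ρ x) = x from vertexTurn_involutive ρ x] at this
        · refine propext ⟨hM' x, fun h => ?_⟩
          have := hM' _ h
          rwa [show M (edgeTurn s x) = x from edgeTurn_involutive s x] at this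
      obtain ⟨j, hj⟩ : ∃ j : ℤ, markedPt I e q' = ((N * M) ^ j) (markedPt I e p) :=
        (iff_of_eq (hle h)).1 ⟨0, rfl⟩
      have := huniq j (by rw [← hj, hMpt])
      rw [← hj] at this
      exact this.imp (fun h => markedPt_injective e h) (fun h => markedPt_injective e h)
    · rintro (rfl | rfl)
      · exact (circuits I ρ s).refl _
      · rw [hi]; exact horb i _
  choose g hg₁ hg₂ using key
  have hinv : ∀ p, g (g p) = p := by
    intro p
    have h := (circuits I ρ s).symm ((hg₂ p (g p)).2 (Or.inr rfl))
    rcases (hg₂ (g p) p).1 h with h | h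
    · exact absurd h.symm (hg₁ p)
    · exact h.symm
  refine ⟨g kleinZero, hg₁ _, fun p q => ?_⟩
  rw [hg₂, eq_kleinAdd_of_involutive g hg₁ hinv p]

/-- The number of circuits of a state. -/
noncomputable def numCircuits (I : Type*) (ρ : Equiv.Perm (E × Bool)) (s : E → Bool × Bool) : ℕ :=
  Nat.card (Quotient (circuits I ρ s))

/-- The marked points that are joined by vertex arcs and by edges. -/
def pieces (I : Type*) (ρ : Equiv.Perm (E × Bool)) : Setoid (((E × Bool) × Bool) ⊕ I) :=
  Relation.EqvGen.setoid fun x y =>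
    y = vertexTurn ρ x ∨ ∃ e p q, x = markedPt I e p ∧ y = markedPt I e q

theorem pieces_vertexTurn (ρ : Equiv.Perm (E × Bool)) (x : ((E × Bool) × Bool) ⊕ I) :
    pieces I ρ x (vertexTurn ρ x) :=
  Relation.EqvGen.rel _ _ (Or.inl rfl)

theorem pieces_markedPt (ρ : Equiv.Perm (E × Bool)) (e : E) (p q : Bool × Bool) :
    pieces I ρ (markedPt I e p) (markedPt I e q) :=
  Relation.EqvGen.rel _ _ (Or.inr ⟨e, p, q, rfl, rfl⟩)

theorem pieces_le {ρ : Equiv.Perm (E × Bool)} {r : Setoid (((E × Bool) × Bool) ⊕ I)}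
    (h₁ : ∀ x, r x (vertexTurn ρ x)) (h₂ : ∀ e p q, r (markedPt I e p) (markedPt I e q)) :
    pieces I ρ ≤ r := by
  apply Setoid.eqvGen_le
  rintro x y (rfl | ⟨e, p, q, rfl, rfl⟩)
  · exact h₁ x
  · exact h₂ e p q

theorem circuits_le_pieces (ρ : Equiv.Perm (E × Bool)) (s : E → Bool × Bool) :
    circuits I ρ s ≤ pieces I ρ :=
  circuits_le (pieces_vertexTurn ρ) fun e _ => pieces_markedPt ρ e _ _

/-- A state is a basis if it has only one circuit on every piece. -/
def IsBasisState (I : Type*) (ρ : Equiv.Perm (E × Bool)) (s : E → Bool × Bool) : Prop :=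
  circuits I ρ s = pieces I ρ

/-- The four marked points of `e` lie on the same circuit of `s`. -/
def IsJoined (I : Type*) (ρ : Equiv.Perm (E × Bool)) (s : E → Bool × Bool) (e : E) : Prop :=
  ∀ p q, circuits I ρ s (markedPt I e p) (markedPt I e q)

theorem isBasisState_of_forall_isJoined {ρ : Equiv.Perm (E × Bool)} {s : E → Bool × Bool}
    (h : ∀ e, IsJoined I ρ s e) : IsBasisState I ρ s :=
  le_antisymm (circuits_le_pieces ρ s) (pieces_le (circuits_vertexTurn ρ s) h)

variable [Finite E] [Finite I]

theorem card_pieces_le (ρ : Equiv.Perm (E × Bool)) (s : E → Bool × Bool) :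
    Nat.card (Quotient (pieces I ρ)) ≤ numCircuits I ρ s :=
  Setoid.card_le_card_of_le (circuits_le_pieces ρ s)

theorem isBasisState_iff {ρ : Equiv.Perm (E × Bool)} {s : E → Bool × Bool} :
    IsBasisState I ρ s ↔ numCircuits I ρ s ≤ Nat.card (Quotient (pieces I ρ)) := by
  refine ⟨fun h => ?_, fun h => Setoid.eq_of_le_of_card_le (circuits_le_pieces ρ s) h⟩
  rw [numCircuits, h]

/-! ### Changing a state at one edge. -/

variable [DecidableEq E]

/-- The effect of the choice of the state at one edge `e`: one of the three choices yields one
circuit more than the other two, and with these two all marked points of `e` are joined. -/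
theorem exists_circuits_update (ρ : Equiv.Perm (E × Bool)) (s : E → Bool × Bool) (e : E)
    (hs : ∀ e', s e' ≠ kleinZero) :
    ∃ k : Bool × Bool, k ≠ kleinZero ∧ ∃ r : Setoid (((E × Bool) × Bool) ⊕ I), ∀ x, x ≠ kleinZero →
      (x = k → circuits I ρ (Function.update s e x) = r) ∧
      (x ≠ k → numCircuits I ρ (Function.update s e x) + 1 = Nat.card (Quotient r) ∧
        r ≤ circuits I ρ (Function.update s e x) ∧ IsJoined I ρ (Function.update s e x) e) := by
  obtain ⟨k, hk, hpair⟩ := exists_pairing (I := I) ρ (Function.update s e kleinZero) e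
    (Function.update_self ..) fun e' he' => by
      rw [Function.update_of_ne he']; exact hs e'
  -- Here `r` is the partition with `e` left unpaired. The points of `e` fall into the two classes
  -- `{0, k}` and `{x, x + k}` for `x` different from `0` and `k`; pairing along `k` adds no
  -- relation, and pairing along such an `x` glues the two classes.
  refine ⟨k, hk, circuits I ρ (Function.update s e kleinZero), fun x hx => ?_⟩
  have hle : circuits I ρ (Function.update s e kleinZero) ≤
      circuits I ρ (Function.update s e x) := by
    refine circuits_le (circuits_vertexTurn _ _) fun e' p => ?_
    by_cases h : e' = e
    · subst h
      rw [Function.update_self, kleinAdd_zero]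
    · have := circuits_markedPt (I := I) ρ (Function.update s e x) e' p
      rwa [Function.update_of_ne h] at this ⊢
  have hge : ∀ t : Setoid (((E × Bool) × Bool) ⊕ I),
      circuits I ρ (Function.update s e kleinZero) ≤ t →
      (∀ p, t (markedPt I e p) (markedPt I e (kleinAdd p x))) →
      circuits I ρ (Function.update s e x) ≤ t := by
    intro t ht hte
    refine circuits_le (fun y => ht (circuits_vertexTurn _ _ y)) fun e' p => ?_
    by_cases h : e' = e
    · subst h
      rw [Function.update_self]
      exact hte p
    · have := ht (circuits_markedPt (I := I) ρ (Function.update s e kleinZero) e' p)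
      rwa [Function.update_of_ne h] at this ⊢
  refine ⟨?_, fun hxk => ?_⟩
  · rintro rfl
    exact le_antisymm (hge _ le_rfl fun p => (hpair _ _).2 (Or.inr rfl)) hle
  · have hjoin : ∀ t : Setoid (((E × Bool) × Bool) ⊕ I),
        circuits I ρ (Function.update s e kleinZero) ≤ t →
        t (markedPt I e kleinZero) (markedPt I e x) →
        ∀ p q, t (markedPt I e p) (markedPt I e q) := by
      intro t ht htx
      have hz : ∀ k, kleinAdd kleinZero k = k := by decide
      have hcases : ∀ k x p : Bool × Bool, k ≠ kleinZero → x ≠ kleinZero → x ≠ k →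
          p = kleinZero ∨ p = k ∨ p = x ∨ p = kleinAdd x k := by decide
      have h0 : ∀ p, t (markedPt I e kleinZero) (markedPt I e p) := by
        intro p
        rcases hcases k x p hk hx hxk with rfl | rfl | rfl | rfl
        · exact t.refl _
        · exact ht ((hpair _ _).2 (Or.inr (hz _).symm))
        · exact htx
        · exact t.trans htx (ht ((hpair _ _).2 (Or.inr rfl)))
      exact fun p q => t.trans (t.symm (h0 p)) (h0 q)
    have hx0 : circuits I ρ (Function.update s e x) (markedPt I e kleinZero) (markedPt I e x) := by
      have := circuits_markedPt (I := I) ρ (Function.update s e x) e kleinZero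
      have hz : ∀ k, kleinAdd kleinZero k = k := by decide
      rwa [Function.update_self, hz] at this
    refine ⟨?_, hle, hjoin _ hle hx0⟩
    refine Setoid.card_quotient_glue _ _ (markedPt I e kleinZero) (markedPt I e x) ?_ hle hx0
      fun t ht htx => hge t ht fun p => hjoin t ht htx _ _
    have hz : ∀ k, kleinAdd kleinZero k = k := by decide
    rw [hpair, hz]
    exact not_or.2 ⟨hx, hxk⟩

/-- All choices at `e` give either the number of classes of `r` or one less. -/
theorem numCircuits_update_le (ρ : Equiv.Perm (E × Bool)) (s : E → Bool × Bool) (e : E)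
    (hs : ∀ e', s e' ≠ kleinZero) {x : Bool × Bool} (hx : x ≠ kleinZero) :
    numCircuits I ρ (Function.update s e x) ≤ numCircuits I ρ s + 1 := by
  obtain ⟨k, -, r, h⟩ := exists_circuits_update (I := I) ρ s e hs
  have key : ∀ y, y ≠ kleinZero →
      numCircuits I ρ (Function.update s e y) ≤ Nat.card (Quotient r) ∧
      Nat.card (Quotient r) ≤ numCircuits I ρ (Function.update s e y) + 1 := by
    intro y hy
    by_cases hk : y = k
    · have h1 := (h y hy).1 hk
      simp only [numCircuits, h1]
      omega
    · have h1 := ((h y hy).2 hk).1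
      omega
  have h1 := key x hx
  have h2 := key (s e) (hs e)
  rw [Function.update_eq_self] at h2
  omega

/-- The points of `e` can only fail to be joined when the state at `e` is the exceptional pairing
`k`; every other choice then merges two circuits. -/
theorem update_of_not_isJoined (ρ : Equiv.Perm (E × Bool)) (s : E → Bool × Bool) (e : E)
    (hs : ∀ e', s e' ≠ kleinZero) {x : Bool × Bool} (hx : x ≠ kleinZero) (hxs : x ≠ s e)
    (he : ¬ IsJoined I ρ s e) :
    numCircuits I ρ (Function.update s e x) + 1 = numCircuits I ρ s ∧
      circuits I ρ s ≤ circuits I ρ (Function.update s e x) ∧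
      IsJoined I ρ (Function.update s e x) e := by
  obtain ⟨k, -, r, h⟩ := exists_circuits_update (I := I) ρ s e hs
  have hk : s e = k := by
    by_contra hk
    have := ((h (s e) (hs e)).2 hk).2.2
    rw [Function.update_eq_self] at this
    exact he this
  have hr := (h (s e) (hs e)).1 hk
  rw [Function.update_eq_self] at hr
  have := (h x hx).2 (hk ▸ hxs)
  rwa [← hr] at this

/-- Of the three choices of the state at an edge, none or exactly two yield a basis. -/
theorem isBasisState_update_kleinAdd (ρ : Equiv.Perm (E × Bool)) (s : E → Bool × Bool) (e : E)
    (hs : ∀ e', s e' ≠ kleinZero) {x y : Bool × Bool} (hx : x ≠ kleinZero) (hy : y ≠ kleinZero)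
    (hxy : x ≠ y) :
    IsBasisState I ρ (Function.update s e (kleinAdd x y)) ↔
      Xor (IsBasisState I ρ (Function.update s e x)) (IsBasisState I ρ (Function.update s e y)) := by
  obtain ⟨k, hk0, r, h⟩ := exists_circuits_update (I := I) ρ s e hs
  have hz : ∀ x y : Bool × Bool, x ≠ kleinZero → y ≠ kleinZero → x ≠ y →
      kleinAdd x y ≠ kleinZero ∧ kleinAdd x y ≠ x ∧ kleinAdd x y ≠ y := by decide
  have hcases : ∀ x y k : Bool × Bool, x ≠ kleinZero → y ≠ kleinZero → x ≠ y →
      k ≠ kleinZero → k = x ∨ k = y ∨ k = kleinAdd x y := by decide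
  obtain ⟨hz0, hzx, hzy⟩ := hz x y hx hy hxy
  have hmax : ∀ w, w = k → w ≠ kleinZero →
      numCircuits I ρ (Function.update s e w) = Nat.card (Quotient r) := fun w hw hw0 => by
    rw [numCircuits, (h w hw0).1 hw]
  have hx' := fun hk => ((h x hx).2 hk).1
  have hy' := fun hk => ((h y hy).2 hk).1
  have hz' := fun hk => ((h _ hz0).2 hk).1
  have mx := card_pieces_le (I := I) ρ (Function.update s e x)
  have my := card_pieces_le (I := I) ρ (Function.update s e y)
  have mz := card_pieces_le (I := I) ρ (Function.update s e (kleinAdd x y))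
  simp only [isBasisState_iff, Xor]
  -- The exceptional `k` is one of `x`, `y`, `x + y`. It has one circuit more than the other two, so
  -- it is never a basis, and the other two are bases simultaneously.
  rcases hcases x y k hx hy hxy hk0 with hk | hk | hk
  · have := hmax x hk.symm hx
    have := hy' fun h => hxy (hk.symm.trans h.symm)
    have := hz' fun h => hzx (h.trans hk)
    omega
  · have := hmax y hk.symm hy
    have := hx' fun h => hxy (h.trans hk)
    have := hz' fun h => hzy (h.trans hk)
    omega
  · have := hmax _ hk.symm hz0
    have := hx' fun h => hzx (hk.symm.trans h.symm)
    have := hy' fun h => hzy (hk.symm.trans h.symm)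
    omega

end Circuits

/-! ### Set systems of basis states, and their twists. -/

section StateSystem

variable {E : Type*}

theorem SetSystem.mem_lower (D : SetSystem E) (F : Finset E) :
    F ∈ D.lower.feasible ↔ F ∈ D.feasible ∧ ∀ F' ∈ D.feasible, F.card ≤ F'.card := by
  simp [SetSystem.lower]

variable [DecidableEq E]

/-- The state that agrees with `b` on `X` and with `a` elsewhere. -/
def mixState (a b : E → Bool × Bool) (X : Finset E) (e : E) : Bool × Bool :=
  if e ∈ X then b e else a e

/-- At every edge `a` and `b` are two different nonzero elements of the Klein four-group. -/
def IsFrame (a b : E → Bool × Bool) : Prop :=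
  ∀ e, a e ≠ kleinZero ∧ b e ≠ kleinZero ∧ a e ≠ b e

theorem mixState_ne_zero {a b : E → Bool × Bool} (hab : IsFrame a b) (X : Finset E) (e : E) :
    mixState a b X e ≠ kleinZero := by
  unfold mixState
  split_ifs
  · exact (hab e).2.1
  · exact (hab e).1

theorem mixState_empty (a b : E → Bool × Bool) : mixState a b ∅ = a := by
  ext1 e
  simp [mixState]

theorem mixState_insert (a b : E → Bool × Bool) (X : Finset E) (e : E) :
    mixState a b (insert e X) = Function.update (mixState a b X) e (b e) := by
  ext1 e'
  by_cases h : e' = e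
  · subst h; simp [mixState]
  · simp [mixState, h]

theorem mixState_erase (a b : E → Bool × Bool) (X : Finset E) (e : E) :
    mixState a b (X.erase e) = Function.update (mixState a b X) e (a e) := by
  ext1 e'
  by_cases h : e' = e
  · subst h; simp [mixState]
  · simp [mixState, h]

theorem mixState_symmDiff_singleton (a b : E → Bool × Bool) {X Y : Finset E} {u : E}
    (hu : u ∈ X ∆ Y) :
    mixState a b (X ∆ {u}) = Function.update (mixState a b X) u (mixState a b Y u) := by
  ext1 e
  rw [Finset.mem_symmDiff] at hu
  by_cases h : e = u
  · subst h
    rw [Function.update_self]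
    simp only [mixState, Finset.mem_symmDiff, Finset.mem_singleton]
    grind
  · rw [Function.update_of_ne h]
    simp [mixState, Finset.mem_symmDiff, h]

theorem mixState_ne_of_mem_symmDiff {a b : E → Bool × Bool} (hab : IsFrame a b) {X Y : Finset E}
    {u : E} : mixState a b Y u ≠ mixState a b X u ↔ u ∈ X ∆ Y := by
  have := (hab u).2.2
  simp only [mixState, Finset.mem_symmDiff]
  grind

theorem IsFrame.kleinAdd_right {a b : E → Bool × Bool} (hab : IsFrame a b) (A : Finset E) :
    IsFrame a (mixState b (fun e => kleinAdd (a e) (b e)) A) := by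
  have h : ∀ x y : Bool × Bool, x ≠ kleinZero → y ≠ kleinZero → x ≠ y →
      kleinAdd x y ≠ kleinZero ∧ x ≠ kleinAdd x y := by decide
  intro e
  have := h _ _ (hab e).1 (hab e).2.1 (hab e).2.2
  refine ⟨(hab e).1, ?_⟩
  unfold mixState
  split_ifs
  · exact this
  · exact (hab e).2

theorem IsFrame.mixState {a b : E → Bool × Bool} (hab : IsFrame a b) (A : Finset E) :
    IsFrame (mixState a b A) (mixState b a A) := by
  intro e
  unfold _root_.mixState
  split_ifs
  · exact ⟨(hab e).2.1, (hab e).1, (hab e).2.2.symm⟩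
  · exact hab e

variable [Fintype E] (I : Type*) (ρ : Equiv.Perm (E × Bool))

open Classical in
/-- The set system of the sets `X` for which the state that is `b` on `X` and `a` elsewhere is a
basis. -/
noncomputable def stateSystem (a b : E → Bool × Bool) : SetSystem E where
  feasible := Finset.univ.filter fun X => IsBasisState I ρ (mixState a b X)

variable {I ρ}

theorem mem_stateSystem {a b : E → Bool × Bool} {X : Finset E} :
    X ∈ (stateSystem I ρ a b).feasible ↔ IsBasisState I ρ (mixState a b X) := by
  simp [stateSystem]

theorem stateSystem_twist (a b : E → Bool × Bool) (A : Finset E) :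
    (stateSystem I ρ a b).twist A = stateSystem I ρ (mixState a b A) (mixState b a A) := by
  have key : ∀ X, mixState (mixState a b A) (mixState b a A) X = mixState a b (A ∆ X) := by
    intro X
    ext1 e
    simp only [mixState, Finset.mem_symmDiff]
    grind
  ext X
  simp only [SetSystem.twist, Finset.mem_image, mem_stateSystem, key]
  constructor
  · rintro ⟨Y, hY, rfl⟩
    rwa [symmDiff_symmDiff_cancel_left]
  · intro h
    exact ⟨A ∆ X, h, symmDiff_symmDiff_cancel_left ..⟩

/-! ### Loop complementation and dual pivot of state systems. -/

variable [Finite I]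

/-- For `e ∈ X`, "exactly one of `X` and `X.erase e` is feasible" is the basis condition for the
third pairing `a e + b e` at `e`, by `isBasisState_update_kleinAdd`. -/
theorem stateSystem_loopComplElem {a b : E → Bool × Bool} (hab : IsFrame a b) (e : E) :
    (stateSystem I ρ a b).loopComplElem e =
      stateSystem I ρ a (Function.update b e (kleinAdd (a e) (b e))) := by
  ext X
  rw [SetSystem.mem_loopComplElem]
  simp only [mem_stateSystem]
  by_cases he : e ∈ X
  · have h1 := isBasisState_update_kleinAdd (I := I) ρ (mixState a b X) e (mixState_ne_zero hab X)
      (hab e).1 (hab e).2.1 (hab e).2.2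
    have h2 : mixState a (Function.update b e (kleinAdd (a e) (b e))) X =
        Function.update (mixState a b X) e (kleinAdd (a e) (b e)) := by
      ext1 e'
      by_cases h : e' = e
      · subst h; simp [mixState, he]
      · simp [mixState, h]
    rw [h2, h1, ← mixState_erase, ← mixState_insert, Finset.insert_eq_of_mem he, xor_comm]
    simp [he]
  · have h2 : mixState a (Function.update b e (kleinAdd (a e) (b e))) X = mixState a b X := by
      ext1 e'
      by_cases h : e' = e
      · subst h; simp [mixState, he]
      · simp [mixState, h]
    simp [he, h2, Xor]

theorem stateSystem_loopCompl {a b : E → Bool × Bool} (hab : IsFrame a b) (A : Finset E) :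
    (stateSystem I ρ a b).loopCompl A =
      stateSystem I ρ a (mixState b (fun e => kleinAdd (a e) (b e)) A) := by
  induction A using Finset.induction_on generalizing b with
  | empty => rw [mixState_empty]; rfl
  | insert e A he ih =>
    have h1 : (stateSystem I ρ a b).loopCompl (insert e A) =
        ((stateSystem I ρ a b).loopComplElem e).loopCompl A := by
      rw [SetSystem.loopCompl, Finset.insert_val_of_notMem he, Multiset.foldl_cons]
      rfl
    have h2 : Function.update b e (kleinAdd (a e) (b e)) =
        mixState b (fun e => kleinAdd (a e) (b e)) {e} := by
      rw [← insert_empty_eq, mixState_insert, mixState_empty]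
    rw [h1, stateSystem_loopComplElem hab, h2, ih (hab.kleinAdd_right {e})]
    congr 1
    ext1 e'
    by_cases h : e' = e
    · subst h; simp [mixState, he]
    · simp [mixState, h]

/-- Exchanging `a` and `b`, adding, and exchanging back turns `a` into `a + b` on `A`. The second
state `c` is left unspecified because the lower rank depends on the first state only. -/
theorem stateSystem_dualPivot {a b : E → Bool × Bool} (hab : IsFrame a b) (A : Finset E) :
    ∃ c, IsFrame (mixState a (fun e => kleinAdd (a e) (b e)) A) c ∧
      (stateSystem I ρ a b).dualPivot A =
        stateSystem I ρ (mixState a (fun e => kleinAdd (a e) (b e)) A) c := by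
  have h1 := (hab.mixState A).kleinAdd_right A
  have h2 := h1.mixState A
  have h3 : mixState (mixState a b A) (mixState (mixState b a A)
      (fun e => kleinAdd (mixState a b A e) (mixState b a A e)) A) A =
      mixState a (fun e => kleinAdd (a e) (b e)) A := by
    have hcomm : ∀ x y : Bool × Bool, kleinAdd x y = kleinAdd y x := by decide
    ext1 e
    by_cases h : e ∈ A
    · simp [mixState, h, hcomm]
    · simp [mixState, h]
  rw [h3] at h2
  refine ⟨_, h2, ?_⟩
  rw [SetSystem.dualPivot, stateSystem_twist, stateSystem_loopCompl (hab.mixState A),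
    stateSystem_twist, h3]

/-! ### Lower rank and symmetric exchange. -/

/-- From every state one reaches a basis by changing the state at `n` further edges, where `n` is
the number of surplus circuits. -/
theorem exists_isBasisState {a b : E → Bool × Bool} (hab : IsFrame a b) (n : ℕ) (X : Finset E)
    (hX : numCircuits I ρ (mixState a b X) = Nat.card (Quotient (pieces I ρ)) + n)
    (hj : ∀ e ∈ X, IsJoined I ρ (mixState a b X) e) :
    ∃ Y, IsBasisState I ρ (mixState a b Y) ∧ Y.card = X.card + n := by
  induction n generalizing X with
  | zero => exact ⟨X, isBasisState_iff.2 hX.le, rfl⟩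
  | succ n ih =>
    have : ∃ e, ¬ IsJoined I ρ (mixState a b X) e := by
      by_contra! h
      have := isBasisState_iff.1 (isBasisState_of_forall_isJoined h)
      omega
    obtain ⟨e, he⟩ := this
    -- Edges already changed stay joined, since each step only merges circuits; hence no edge is
    -- used twice and the cardinality grows by one.
    have heX : e ∉ X := fun h => he (hj e h)
    have hbe : b e ≠ mixState a b X e := by
      simpa [mixState, heX] using (hab e).2.2.symm
    obtain ⟨h1, h2, h3⟩ := update_of_not_isJoined ρ (mixState a b X) e (mixState_ne_zero hab X)
      (hab e).2.1 hbe he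
    rw [← mixState_insert] at h1 h2 h3
    obtain ⟨Y, hY, hc⟩ := ih (insert e X) (by omega) (by
      intro e' he'
      rcases Finset.mem_insert.1 he' with rfl | he'
      · exact h3
      · exact fun p q => h2 (hj e' he' p q))
    refine ⟨Y, hY, ?_⟩
    rw [hc, Finset.card_insert_of_notMem heX]
    omega

theorem numCircuits_le_add_card {a b : E → Bool × Bool} (hab : IsFrame a b) (X : Finset E) :
    numCircuits I ρ a ≤ numCircuits I ρ (mixState a b X) + X.card := by
  induction X using Finset.induction_on with
  | empty => rw [mixState_empty]; simp
  | insert e X he ih =>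
    have h := numCircuits_update_le (I := I) ρ (mixState a b (insert e X)) e
      (mixState_ne_zero hab _) (hab e).1
    rw [← mixState_erase, Finset.erase_insert he] at h
    rw [Finset.card_insert_of_notMem he]
    omega

/-- One edge removes at most one circuit, so a feasible set has at least as many elements as `a` has
surplus circuits; `exists_isBasisState` from the empty set attains this bound. -/
theorem lowerRank_stateSystem {a b : E → Bool × Bool} (hab : IsFrame a b) :
    numCircuits I ρ a =
      Nat.card (Quotient (pieces I ρ)) + (stateSystem I ρ a b).lowerRank := by
  obtain ⟨n, hn⟩ := Nat.exists_eq_add_of_le (card_pieces_le (I := I) ρ a)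
  obtain ⟨Y, hY, hc⟩ := exists_isBasisState (I := I) (ρ := ρ) hab n ∅
    (by rw [mixState_empty, hn]) (by simp)
  rw [Finset.card_empty, zero_add] at hc
  have hmin : ∀ Z ∈ (stateSystem I ρ a b).feasible, n ≤ Z.card := by
    intro Z hZ
    have h1 := isBasisState_iff.1 (mem_stateSystem.1 hZ)
    have h2 := numCircuits_le_add_card (I := I) (ρ := ρ) hab Z
    omega
  have hYl : Y ∈ (stateSystem I ρ a b).lower.feasible := by
    exact (SetSystem.mem_lower _ _).2 ⟨mem_stateSystem.2 hY, fun Z hZ => hc ▸ hmin Z hZ⟩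
  suffices h : (stateSystem I ρ a b).lowerRank = n by rw [h, hn]
  unfold SetSystem.lowerRank SetSystem.rank
  apply le_antisymm
  · refine Finset.sup_le fun Z hZ => ?_
    rw [Finset.univ_inter, ← hc]
    exact ((SetSystem.mem_lower _ _).1 hZ).2 Y (mem_stateSystem.2 hY)
  · have := Finset.le_sup (f := fun B => (Finset.univ ∩ B).card) hYl
    rwa [Finset.univ_inter, hc] at this

/-- Changing `u` creates at most one surplus circuit. If it does, the basis `Y` must have at some
edge `v` a pairing that connects different circuits of the new state; adopting it at `v` removes the
surplus. -/
theorem isDeltaMatroid_stateSystem {a b : E → Bool × Bool} (hab : IsFrame a b) :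
    (stateSystem I ρ a b).IsDeltaMatroid := by
  refine ⟨?_, fun X hX Y hY u hu => ?_⟩
  · obtain ⟨n, hn⟩ := Nat.exists_eq_add_of_le (card_pieces_le (I := I) ρ a)
    obtain ⟨Y, hY, -⟩ := exists_isBasisState (I := I) (ρ := ρ) hab n ∅
      (by rw [mixState_empty, hn]) (by simp)
    exact ⟨Y, mem_stateSystem.2 hY⟩
  · rw [mem_stateSystem] at hX hY
    by_cases hb : IsBasisState I ρ (mixState a b (X ∆ {u}))
    · exact ⟨u, hu, by rw [Finset.pair_eq_singleton]; exact mem_stateSystem.2 hb⟩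
    have hv : ∃ v p, ¬ circuits I ρ (mixState a b (X ∆ {u})) (markedPt I v p)
        (markedPt I v (kleinAdd p (mixState a b Y v))) := by
      by_contra! h
      refine hb (le_antisymm (circuits_le_pieces _ _) ?_)
      rw [← hY]
      exact circuits_le (circuits_vertexTurn _ _) h
    obtain ⟨v, p, hv⟩ := hv
    -- The states of `Y` and of `X ∆ {u}` differ at `v` but agree at `u`, so `v ∈ X ∆ Y` and `v ≠
    -- u`.
    have hne : mixState a b Y v ≠ mixState a b (X ∆ {u}) v := by
      intro h
      rw [h] at hv
      exact hv (circuits_markedPt _ _ _ _)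
    have hv' : v ∈ (X ∆ {u}) ∆ Y := (mixState_ne_of_mem_symmDiff hab).1 hne
    have hvu : v ≠ u := by
      rintro rfl
      rw [mixState_symmDiff_singleton a b hu, Function.update_self] at hne
      exact hne rfl
    refine ⟨v, ?_, ?_⟩
    · simpa [Finset.mem_symmDiff, hvu] using hv'
    · have hXuv : X ∆ {u, v} = (X ∆ {u}) ∆ {v} := by
        ext e
        simp only [Finset.mem_symmDiff, Finset.mem_insert, Finset.mem_singleton]
        grind
      have h1 := (update_of_not_isJoined (I := I) ρ _ v (mixState_ne_zero hab (X ∆ {u}))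
        (mixState_ne_zero hab Y v) hne fun h => hv (h _ _)).1
      have h2 := numCircuits_update_le (I := I) ρ _ u (mixState_ne_zero hab X)
        (mixState_ne_zero hab Y u)
      rw [← mixState_symmDiff_singleton a b hu] at h2
      rw [← mixState_symmDiff_singleton a b hv', ← hXuv] at h1
      have h3 := isBasisState_iff.1 hX
      rw [mem_stateSystem, isBasisState_iff]
      omega

theorem isVfSafe_stateSystem {a b : E → Bool × Bool} (hab : IsFrame a b) :
    (stateSystem I ρ a b).IsVfSafe := by
  have key : ∀ D, (stateSystem I ρ a b).Reaches D →
      ∃ a' b', IsFrame a' b' ∧ D = stateSystem I ρ a' b' := by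
    intro D hD
    induction hD with
    | refl => exact ⟨a, b, hab, rfl⟩
    | twist A _ ih =>
      obtain ⟨a', b', h, rfl⟩ := ih
      exact ⟨_, _, h.mixState A, stateSystem_twist ..⟩
    | loopCompl A _ ih =>
      obtain ⟨a', b', h, rfl⟩ := ih
      exact ⟨_, _, h.kleinAdd_right A, stateSystem_loopCompl h A⟩
  intro D hD
  obtain ⟨a', b', h, rfl⟩ := key D hD
  exact isDeltaMatroid_stateSystem h

end StateSystem

/-! ### Pieces as connected components of the ribbon graph. -/

namespace RibbonGraph

variable {V E : Type*} (G : RibbonGraph V E)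

/-- The vertex discs without edge ends. -/
abbrev Isolated : Type _ := {v : V // ∀ h : E × Bool, G.vert h ≠ v}

theorem vertex_surjective : Function.Surjective (MarkedPoint.vertex G) := by
  intro v
  by_cases h : ∃ h, G.vert h = v
  · obtain ⟨h, rfl⟩ := h
    exact ⟨Sum.inl (h, false), rfl⟩
  · push Not at h
    exact ⟨Sum.inr ⟨v, h⟩, rfl⟩

/-- The ends on one vertex form a cycle of `rot`; vertex arcs lead from one end to the next, and the
edges bridge the two points of each end. -/
theorem pieces_of_vertex_eq {p q : G.MarkedPoint}
    (h : MarkedPoint.vertex G p = MarkedPoint.vertex G q) : pieces G.Isolated G.rot p q := by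
  have hseg : ∀ (h : E × Bool) (i j : Bool),
      pieces G.Isolated G.rot (Sum.inl (h, i)) (Sum.inl (h, j)) :=
    fun h i j => pieces_markedPt G.rot h.1 (h.2, i) (h.2, j)
  have hrot : ∀ h : E × Bool,
      pieces G.Isolated G.rot (Sum.inl (h, true)) (Sum.inl (G.rot h, true)) := fun h =>
    (pieces _ _).trans (pieces_vertexTurn G.rot (Sum.inl (h, true))) (hseg _ _ _)
  have hpow : ∀ (n : ℤ) (h : E × Bool),
      pieces G.Isolated G.rot (Sum.inl (h, true)) (Sum.inl ((G.rot ^ n) h, true)) := by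
    intro n h
    induction n with
    | zero => exact (pieces _ _).refl _
    | succ n ih =>
      rw [add_comm, zpow_add, zpow_one, Equiv.Perm.mul_apply]
      exact (pieces _ _).trans ih (hrot _)
    | pred n ih =>
      rw [sub_eq_add_neg, add_comm, zpow_add, zpow_neg_one, Equiv.Perm.mul_apply]
      refine (pieces _ _).trans ih ((pieces _ _).symm ?_)
      have := hrot (G.rot⁻¹ ((G.rot ^ (-(n : ℤ))) h))
      rwa [show ∀ y, G.rot (G.rot⁻¹ y) = y from G.rot.apply_symm_apply] at this
  rcases p with ⟨h₁, i⟩ | v <;> rcases q with ⟨h₂, j⟩ | w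
  · obtain ⟨n, rfl⟩ := (G.vert_eq_iff h₁ h₂).1 h
    exact (pieces _ _).trans (hseg _ _ _) ((pieces _ _).trans (hpow n h₁) (hseg _ _ _))
  · exact absurd h (w.2 _)
  · exact absurd h.symm (v.2 _)
  · rw [Subtype.ext (show v.1 = w.1 from h)]

theorem pieces_iff (p q : G.MarkedPoint) :
    pieces G.Isolated G.rot p q ↔
      G.graph.connectedComponentMk (MarkedPoint.vertex G p) =
        G.graph.connectedComponentMk (MarkedPoint.vertex G q) := by
  constructor
  · have hle : pieces G.Isolated G.rot ≤
        Setoid.ker fun p => G.graph.connectedComponentMk (MarkedPoint.vertex G p) := by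
      refine pieces_le ?_ ?_
      · rintro (⟨h, _ | _⟩ | i)
        · refine congrArg G.graph.connectedComponentMk ((G.vert_eq_iff _ _).2 ?_)
          exact ⟨-1, by simp⟩
        · refine congrArg G.graph.connectedComponentMk ((G.vert_eq_iff _ _).2 ?_)
          exact ⟨1, by simp⟩
        · exact Setoid.refl' _ _
      · rintro e p q
        have h0 : G.graph.connectedComponentMk (G.vert (e, false)) =
            G.graph.connectedComponentMk (G.vert (e, true)) := by
          by_cases hv : G.vert (e, false) = G.vert (e, true)
          · rw [hv]
          · exact SimpleGraph.ConnectedComponent.sound (SimpleGraph.Adj.reachable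
              ((SimpleGraph.fromRel_adj ..).2 ⟨hv, Or.inl ⟨e, rfl, rfl⟩⟩))
        have h1 : ∀ i : Bool, G.graph.connectedComponentMk (G.vert (e, i)) =
            G.graph.connectedComponentMk (G.vert (e, false)) := by
          rintro (_ | _)
          · rfl
          · exact h0.symm
        exact (h1 p.1).trans (h1 q.1).symm
    exact fun h => hle h
  · intro h
    have key : ∀ v w, G.graph.Reachable v w → ∀ p q : G.MarkedPoint,
        MarkedPoint.vertex G p = v → MarkedPoint.vertex G q = w →
        pieces G.Isolated G.rot p q := by
      rintro v w ⟨W⟩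
      induction W with
      | nil => exact fun p q hp hq => G.pieces_of_vertex_eq (hp.trans hq.symm)
      | cons hadj _ ih =>
        intro p q hp hq
        rcases ((SimpleGraph.fromRel_adj ..).1 hadj).2 with ⟨e, h1, h2⟩ | ⟨e, h1, h2⟩
        · exact (pieces _ _).trans (G.pieces_of_vertex_eq (q := Sum.inl ((e, false), false))
            (hp.trans h1.symm)) ((pieces _ _).trans (pieces_markedPt G.rot e (false, false)
              (true, false)) (ih (Sum.inl ((e, true), false)) q h2 hq))
        · exact (pieces _ _).trans (G.pieces_of_vertex_eq (q := Sum.inl ((e, true), false))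
            (hp.trans h2.symm)) ((pieces _ _).trans (pieces_markedPt G.rot e (true, false)
              (false, false)) (ih (Sum.inl ((e, false), false)) q h1 hq))
    exact key _ _ (SimpleGraph.ConnectedComponent.exact h) p q rfl rfl

theorem numComponents_eq :
    G.numComponents = Nat.card (Quotient (pieces G.Isolated G.rot)) := by
  have h : pieces G.Isolated G.rot =
      Setoid.ker fun p => G.graph.connectedComponentMk (MarkedPoint.vertex G p) :=
    Setoid.ext fun p q => G.pieces_iff p q
  rw [h]
  refine (Nat.card_congr (Setoid.quotientKerEquivOfSurjective _ ?_)).symm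
  intro K
  obtain ⟨v, rfl⟩ := K.exists_rep
  obtain ⟨p, rfl⟩ := G.vertex_surjective v
  exact ⟨p, rfl⟩

/-! ### Boundary components as circuits, and quasi-trees as bases. -/

variable [DecidableEq E]

/-- The state that pairs up the marked points of an edge along its free sides. -/
def sideState (e : E) : Bool × Bool := (true, !decide (e ∈ G.twisted))

/-- The state that pairs up the marked points of an edge along the segments of its ends. -/
def segmentState (_ : E) : Bool × Bool := (false, true)

theorem isFrame_segmentState_sideState : IsFrame segmentState G.sideState := by
  intro e
  simp [segmentState, sideState]

/-- A half-twist exchanges the two points at one end of an edge. This adds `(false, true)`, which is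
`segmentState`, so the twisted sides are the third pairing. -/
theorem sideState_petrial (A : Finset E) :
    (G.petrial A).sideState =
      mixState G.sideState (fun e => kleinAdd (segmentState e) (G.sideState e)) A := by
  ext1 e
  simp only [sideState, petrial, mixState, segmentState, kleinAdd, Finset.mem_symmDiff]
  by_cases h1 : e ∈ A <;> by_cases h2 : e ∈ G.twisted <;> simp [h1, h2]

/-- The boundary components of `(V, A)` are the circuits of the corresponding state. -/
theorem boundary_reachable_iff (A : Finset E) (p q : G.MarkedPoint) :
    (G.boundary A).Reachable p q ↔
      circuits G.Isolated G.rot (mixState segmentState G.sideState A) p q := by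
  constructor
  · have harc : ∀ p q, G.BoundaryArc A p q →
        circuits G.Isolated G.rot (mixState segmentState G.sideState A) p q := by
      intro p q h
      cases h with
      | vertexArc h => exact circuits_vertexTurn G.rot _ (Sum.inl (h, true))
      | segment h hh =>
        have := circuits_markedPt (I := G.Isolated) G.rot
          (mixState segmentState G.sideState A) h.1 (h.2, false)
        simpa [mixState, hh, segmentState, kleinAdd, markedPt] using this
      | side e he s =>
        have := circuits_markedPt (I := G.Isolated) G.rot
          (mixState segmentState G.sideState A) e (false, s)
        by_cases ht : e ∈ G.twisted
        · simpa [mixState, he, sideState, kleinAdd, markedPt, ht] using this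
        · simpa [mixState, he, sideState, kleinAdd, markedPt, ht] using this
    rintro ⟨w⟩
    induction w with
    | nil => exact (circuits _ _ _).refl _
    | cons h _ ih =>
      refine (circuits _ _ _).trans ?_ ih
      rcases ((SimpleGraph.fromRel_adj ..).1 h).2 with h | h
      · exact harc _ _ h
      · exact (circuits _ _ _).symm (harc _ _ h)
  · have harc : ∀ p q, G.BoundaryArc A p q → (G.boundary A).Reachable p q := by
      intro p q h
      by_cases hpq : p = q
      · rw [hpq]
      · exact SimpleGraph.Adj.reachable ((SimpleGraph.fromRel_adj ..).2 ⟨hpq, Or.inl h⟩)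
    have hle : circuits G.Isolated G.rot (mixState segmentState G.sideState A) ≤
        (G.boundary A).reachableSetoid := by
      refine circuits_le ?_ ?_
      · rintro (⟨h, _ | _⟩ | i)
        · have := harc _ _ (BoundaryArc.vertexArc (A := A) (G.rot⁻¹ h))
          rw [show G.rot (G.rot⁻¹ h) = h from G.rot.apply_symm_apply h] at this
          exact this.symm
        · exact harc _ _ (BoundaryArc.vertexArc h)
        · exact SimpleGraph.Reachable.refl _
      · rintro e ⟨i, j⟩
        change (G.boundary A).Reachable _ _
        by_cases he : e ∈ A
        · have hs := fun s => harc _ _ (BoundaryArc.side (G := G) (A := A) e he s)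
          by_cases ht : e ∈ G.twisted
          · have := hs j
            cases i
            · simpa [mixState, he, sideState, kleinAdd, markedPt, ht] using this
            · simpa [mixState, he, sideState, kleinAdd, markedPt, ht] using this.symm
          · cases i
            · simpa [mixState, he, sideState, kleinAdd, markedPt, ht] using hs j
            · simpa [mixState, he, sideState, kleinAdd, markedPt, ht] using (hs (!j)).symm
        · have := harc _ _ (BoundaryArc.segment (G := G) (A := A) (e, i) he)
          cases j
          · simpa [mixState, he, segmentState, kleinAdd, markedPt] using this
          · simpa [mixState, he, segmentState, kleinAdd, markedPt] using this.symm
    exact fun h => hle h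

theorem numBoundary_eq (A : Finset E) :
    G.numBoundary A = numCircuits G.Isolated G.rot (mixState segmentState G.sideState A) := by
  refine Nat.card_congr (Quotient.congr (ra := (G.boundary A).reachableSetoid)
    (rb := circuits G.Isolated G.rot _) (Equiv.refl _) fun p q => ?_)
  exact G.boundary_reachable_iff A p q

theorem isSpanningQuasiTree_iff (A : Finset E) :
    G.IsSpanningQuasiTree A ↔
      IsBasisState G.Isolated G.rot (mixState segmentState G.sideState A) := by
  constructor
  · intro h
    refine le_antisymm (circuits_le_pieces _ _) fun p q hpq => ?_
    obtain ⟨b, -, hb⟩ := h (G.graph.connectedComponentMk (MarkedPoint.vertex G p))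
    have h1 := hb _ ⟨p, rfl, rfl⟩
    have h2 := hb _ ⟨q, rfl, ((G.pieces_iff p q).1 hpq).symm⟩
    exact (G.boundary_reachable_iff A p q).1
      (SimpleGraph.ConnectedComponent.exact (h1.trans h2.symm))
  · intro h K
    obtain ⟨v, rfl⟩ := K.exists_rep
    obtain ⟨p, rfl⟩ := G.vertex_surjective v
    refine ⟨_, ⟨p, rfl, rfl⟩, ?_⟩
    rintro _ ⟨q, rfl, hq⟩
    refine SimpleGraph.ConnectedComponent.sound ((G.boundary_reachable_iff A q p).2 ?_)
    rw [h]
    exact (G.pieces_iff q p).2 hq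

theorem deltaMatroid_eq [Fintype E] :
    G.deltaMatroid = stateSystem G.Isolated G.rot segmentState G.sideState := by
  ext X
  simp [deltaMatroid, stateSystem, isSpanningQuasiTree_iff]

/-- Both sides count the circuits of the state that follows the sides on `A`, the segments on `B`
and the half-twisted sides on `C`. The frame starts from the segments, so the twist is along the
kept edges `A`, not the deleted edges `B`. -/
theorem numBoundary_petrial [Fintype V] [Fintype E] {A B C : Finset E}
    (hABC : (A, B, C) ∈ orderedPartitions3 E) :
    (G.petrial C).numBoundary Bᶜ =
      G.numComponents + ((G.deltaMatroid.twist A).dualPivot C).lowerRank := by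
  simp only [orderedPartitions3, Finset.mem_filter, Finset.mem_univ, true_and] at hABC
  obtain ⟨hu, hAB, hAC, hBC⟩ := hABC
  have hf := G.isFrame_segmentState_sideState
  obtain ⟨c, hc, hpiv⟩ := stateSystem_dualPivot (I := G.Isolated) (ρ := G.rot) (hf.mixState A) C
  rw [deltaMatroid_eq, stateSystem_twist, hpiv, numComponents_eq, ← lowerRank_stateSystem hc,
    numBoundary_eq, sideState_petrial]
  -- The Petrial has the same vertices and rotation, hence definitionally the same marked points.
  change numCircuits G.Isolated G.rot _ = _
  congr 1
  ext1 e
  have h1 : e ∈ A ∨ e ∈ B ∨ e ∈ C := by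
    have := Finset.mem_univ e
    rw [← hu] at this
    simpa [or_assoc] using this
  have h2 : e ∈ A → e ∉ B := fun h => Finset.disjoint_left.1 hAB h
  have h3 : e ∈ A → e ∉ C := fun h => Finset.disjoint_left.1 hAC h
  have h4 : e ∈ B → e ∉ C := fun h => Finset.disjoint_left.1 hBC h
  by_cases hA : e ∈ A
  · simp [mixState, hA, h2 hA, h3 hA]
  · by_cases hB : e ∈ B
    · simp [mixState, hA, hB, h4 hB]
    · have hC : e ∈ C := (h1.resolve_left hA).resolve_left hB
      simp [mixState, hA, hB, hC]

end RibbonGraph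

/-! ### Comparison of the two transition polynomials. -/

/-- For every ribbon graph `G` the set system `D(G)` is a vf-safe delta-matroid, and for every
weight system `(α, β, γ)` one has `Q(G; (α, β, γ), t) = t ^ k(G) * Q_{(β, α, γ)}(D(G); t)`. -/
theorem mainTheorem10 {V E : Type*} [Fintype V] [Fintype E] [DecidableEq E]
    (G : RibbonGraph V E) :
    G.deltaMatroid.IsVfSafe ∧
      ∀ α β γ : E → ℤ,
        G.transitionPoly α β γ =
          (Polynomial.X : Polynomial ℤ) ^ G.numComponents *
            G.deltaMatroid.transitionPoly β α γ := by
  refine ⟨?_, fun α β γ => ?_⟩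
  · rw [G.deltaMatroid_eq]
    exact isVfSafe_stateSystem G.isFrame_segmentState_sideState
  · have hswap : ∀ P ∈ orderedPartitions3 E, (P.2.1, P.1, P.2.2) ∈ orderedPartitions3 E := by
      intro P hP
      simp only [orderedPartitions3, Finset.mem_filter, Finset.mem_univ, true_and] at hP ⊢
      obtain ⟨hu, hAB, hAC, hBC⟩ := hP
      exact ⟨by rw [Finset.union_comm P.2.1, hu], hAB.symm, hBC, hAC⟩
    rw [RibbonGraph.transitionPoly, SetSystem.transitionPoly, Finset.mul_sum]
    -- The delta-matroid is twisted along the second block, but the term to match needs a twist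
    -- along the first one; exchanging these blocks also exchanges `α` and `β`.
    refine Finset.sum_bij' (fun P _ => (P.2.1, P.1, P.2.2)) (fun P _ => (P.2.1, P.1, P.2.2))
      hswap hswap (fun _ _ => rfl) (fun _ _ => rfl) fun P hP => ?_
    rw [G.numBoundary_petrial hP, pow_add, mul_comm (∏ e ∈ P.1, α e)]
    ring
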